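/- Theorem. For $\varphi\in[0,2\pi)$ let $\neg_\varphi$ and $H_\varphi$ be the unitary transformations of $\mathbb{C}^2$ given by $\neg_\varphi|0\rangle=e^{i\varphi}|1\rangle$, $\neg_\varphi(e^{i\varphi}|1\rangle)=|0\rangle$, $H_\varphi|0\rangle=(|0\rangle+e^{i\varphi}|1\rangle)/\sqrt2$, $H_\varphi(e^{i\varphi}|1\rangle)=(|0\rangle-e^{i\varphi}|1\rangle)/\sqrt2$, and let $\text{c-NOT}_\varphi$ be the unitary transformation of $\mathbb{C}^2\otimes\mathbb{C}^2$ with $\text{c-NOT}_\varphi(|0\rangle|\psi\rangle)=|0\rangle|\psi\rangle$ and $\text{c-NOT}_\varphi(|1\rangle|\psi\rangle)=|1\rangle(\neg_\varphi|\psi\rangle)$ for all $|\psi\rangle\in\mathbb{C}^2$. For a unitary $A$, let $\mathbf{A}$ denote the superoperator $\rho\mapsto A\rho A^\dagger$. A superoperator for $n$ qubits is a linear transformation of $\mathbb{C}^{2^n\times 2^n}$. It is completely positive (a CPSO) if it maps density matrices (positive semidefinite of trace $1$) to density matrices, and its tensor product with the identity on $\mathbb{C}^{M\times M}$ does so too,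 for every $M\ge1$. Write $\mathrm{Pr}^v(\rho)=\langle v|\rho|v\rangle$ for $v\in\{0,1\}^n$. An experimental equation in two CPSO variables $(\mathbf{F},\mathbf{G})$ is an equation $\mathrm{Pr}^v(X_1^{k_1}\circ\cdots\circ X_t^{k_t}(|w\rangle\langle w|))=r$ for $n$ qubits, with $v,w\in\{0,1\}^n$, integers $k_i\ge0$ and $0\le r\le1$, where each $X_i$ is $\mathbf{F}$, $\mathbf{G}$, a tensor product of two of these variables, or a tensor product of one of them with an identity. A set of such equations characterizes a family of pairs of superoperators if this family consists exactly of the pairs of CPSOs that satisfy all the equations. The family $\{(\mathbf{H}_\varphi,\textbf{c-NOT}_\varphi):\varphi\in[0,2\pi)\}$ is characterized by the following finite set of experimental equations, in which $\mathbf{F}$ is a CPSO for one qubit, $\mathbf{G}$ is a CPSO for two qubits and $\mathbf{I}_2$ is the identity on $\mathbb{C}^{2\times2}$: $$\mathrm{Pr}^{0}(\mathbf{F}(|0\rangle\langle0|))=\tfrac12,\quad \mathrm{Pr}^{0}(\mathbf{F}^2(|0\rangle\langle0|))=1,\quad \mathrm{Pr}^{0}(\mathbf{F}^2(|1\rangle\langle1|))=0,$$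 $$\mathrm{Pr}^{00}(\mathbf{G}(|00\rangle\langle00|))=1,\quad \mathrm{Pr}^{01}(\mathbf{G}(|01\rangle\langle01|))=1,\quad \mathrm{Pr}^{11}(\mathbf{G}(|10\rangle\langle10|))=1,\quad \mathrm{Pr}^{10}(\mathbf{G}(|11\rangle\langle11|))=1,$$ $$\mathrm{Pr}^{00}((\mathbf{I}_2\otimes\mathbf{F})\circ\mathbf{G}\circ(\mathbf{I}_2\otimes\mathbf{F})(|00\rangle\langle00|))=1,\quad \mathrm{Pr}^{10}((\mathbf{I}_2\otimes\mathbf{F})\circ\mathbf{G}\circ(\mathbf{I}_2\otimes\mathbf{F})(|10\rangle\langle10|))=1,$$ $$\mathrm{Pr}^{00}((\mathbf{F}\otimes\mathbf{I}_2)\circ\mathbf{G}^2\circ(\mathbf{F}\otimes\mathbf{I}_2)(|00\rangle\langle00|))=1,\quad \mathrm{Pr}^{01}((\mathbf{F}\otimes\mathbf{I}_2)\circ\mathbf{G}^2\circ(\mathbf{F}\otimes\mathbf{I}_2)(|01\rangle\langle01|))=1,$$ $$\mathrm{Pr}^{00}((\mathbf{F}\otimes\mathbf{F})\circ\mathbf{G}\circ(\mathbf{F}\otimes\mathbf{F})(|00\rangle\langle00|))=1.$$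 -/

import Mathlib

open scoped ComplexOrder

noncomputable section

namespace QSelfTest

/-- The computational basis `{0,1}ⁿ` of `n` qubits. -/
abbrev Qubits (n : ℕ) : Type := Fin n → Fin 2

/-! ### Density matrices and superoperators -/

/-- A density matrix: Hermitian positive semidefinite of trace one. -/
def IsDensity {ι : Type*} [Fintype ι] (ρ : Matrix ι ι ℂ) : Prop :=
  ρ.PosSemidef ∧ ρ.trace = 1

/-- A superoperator: a linear transformation of the space of square complex matrices.
Multiplication of superoperators is composition, `1` is the identity superoperator. -/
abbrev Superop (ι : Type*) : Type _ := Module.End ℂ (Matrix ι ι ℂ)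

/-- A positive superoperator sends density matrices to density matrices. -/
def IsPSO {ι : Type*} [Fintype ι] (S : Superop ι) : Prop :=
  ∀ ρ : Matrix ι ι ℂ, IsDensity ρ → IsDensity (S ρ)

/-- The tensor product of two superoperators, that is, the superoperator `S ⊗ T` such that
`(S ⊗ T) (A ⊗ B) = S A ⊗ T B` for all matrices `A` and `B`. -/
def superTensor {ι κ : Type*} [Fintype ι] [DecidableEq ι] [Fintype κ] [DecidableEq κ]
    (S : Superop ι) (T : Superop κ) : Superop (ι × κ) :=
  (_root_.kroneckerLinearEquiv ι ι κ κ ℂ).conj (TensorProduct.map S T)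

/-- A completely positive superoperator (CPSO): a positive superoperator `S` such that
`S ⊗ I_M` is positive for every positive integer `M`. -/
def IsCPSO {ι : Type*} [Fintype ι] [DecidableEq ι] (S : Superop ι) : Prop :=
  IsPSO S ∧ ∀ M : ℕ, 0 < M → IsPSO (superTensor S (1 : Superop (Fin M)))

/-- The tensor product of a superoperator for `m` qubits (the first ones) and a superoperator
for `n` qubits (the last ones), as a superoperator for `m + n` qubits: `|v⟩ ⊗ |w⟩` is
identified with `|vw⟩`, where `vw` is the concatenation of `v` and `w`. -/
def qubitTensor {m n : ℕ} (S : Superop (Qubits m)) (T : Superop (Qubits n)) :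
    Superop (Qubits (m + n)) :=
  (Matrix.reindexLinearEquiv ℂ ℂ (Fin.appendEquiv m n) (Fin.appendEquiv m n)).conj
    (superTensor S T)

/-- The superoperator `ρ ↦ A ρ A†`. When `A` is unitary, this is the unitary superoperator
that `A` induces. -/
def conjSuper {ι : Type*} [Fintype ι] (A : Matrix ι ι ℂ) : Superop ι where
  toFun ρ := A * ρ * A.conjTranspose
  map_add' ρ τ := by rw [mul_add, add_mul]
  map_smul' c ρ := by simp

/-- The density matrix `|w⟩⟨w|` of the computational basis state `|w⟩`. -/
def basisState {n : ℕ} (w : Qubits n) : Matrix (Qubits n) (Qubits n) ℂ :=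
  Matrix.single w w 1

/-- `Prᵛ(ρ) = ⟨v|ρ|v⟩`, the probability of measuring `|v⟩⟨v|` in the state `ρ`. -/
def prob {n : ℕ} (v : Qubits n) (ρ : Matrix (Qubits n) (Qubits n) ℂ) : ℝ :=
  (ρ v v).re

/-! ### Experimental equations in two variables `(F, G)` -/

/-- The two CPSO variables: `F` for one qubit and `G` for two qubits. -/
inductive GateVar : ℕ → Type
  | F : GateVar 1
  | G : GateVar 2

/-- What may be applied to a register of `n` qubits: a CPSO variable, the tensor product of two
CPSO variables, or the tensor product (on either side) of a CPSO variable with the identity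
on `k` qubits. -/
inductive GateTerm : ℕ → Type
  | var {n : ℕ} (X : GateVar n) : GateTerm n
  | tensor {m n : ℕ} (X : GateVar m) (Y : GateVar n) : GateTerm (m + n)
  | tensorId {m : ℕ} (X : GateVar m) (k : ℕ) : GateTerm (m + k)
  | idTensor (k : ℕ) {m : ℕ} (X : GateVar m) : GateTerm (k + m)

/-- A pair consisting of a superoperator for one qubit and a superoperator for two qubits. -/
abbrev GatePair : Type := Superop (Qubits 1) × Superop (Qubits 2)

/-- The value of a variable under an assignment of the pair `(F, G)`. -/
def GateVar.eval (p : GatePair) : {n : ℕ} → GateVar n → Superop (Qubits n)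
  | _, .F => p.1
  | _, .G => p.2

/-- The value of a gate term under an assignment of the pair `(F, G)`. -/
def GateTerm.eval (p : GatePair) : {n : ℕ} → GateTerm n → Superop (Qubits n)
  | _, .var X => X.eval p
  | _, .tensor X Y => qubitTensor (X.eval p) (Y.eval p)
  | _, .tensorId X k => qubitTensor (X.eval p) (1 : Superop (Qubits k))
  | _, .idTensor k X => qubitTensor (1 : Superop (Qubits k)) (X.eval p)

/-- An experimental equation `Prᵛ(X₁^{k₁} ∘ ⋯ ∘ Xₜ^{kₜ} (|w⟩⟨w|)) = r` for `n` qubits, where the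
`Xᵢ` are gate terms, the `kᵢ` are non-negative integers and `0 ≤ r ≤ 1`. -/
structure ExpEquation where
  /-- The number of qubits of the register. -/
  n : ℕ
  /-- The bit string `v` of the measurement outcome. -/
  outcome : Qubits n
  /-- The list `(X₁, k₁), …, (Xₜ, kₜ)`. -/
  word : List (GateTerm n × ℕ)
  /-- The bit string `w` of the initial state. -/
  input : Qubits n
  /-- The constant term `r`. -/
  const : Set.Icc (0 : ℝ) 1

/-- The pair `p` satisfies the experimental equation `e`. -/
def ExpEquation.Holds (e : ExpEquation) (p : GatePair) : Prop :=
  prob e.outcome ((e.word.map fun x => x.1.eval p ^ x.2).prod (basisState e.input)) = e.const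

/-- The set of all pairs of CPSOs that satisfy all the equations in `E`. -/
def solutions (E : Set ExpEquation) : Set GatePair :=
  {p | IsCPSO p.1 ∧ IsCPSO p.2 ∧ ∀ e ∈ E, e.Holds p}

/-- `E` is a finite set of experimental equations which characterizes the family `𝓕`:
the pairs of CPSOs that satisfy `E` are exactly the members of `𝓕`. -/
def Characterizes (E : Set ExpEquation) (𝓕 : Set GatePair) : Prop :=
  E.Finite ∧ solutions E = 𝓕

/-! ### The gates -/

/-- `H_φ|0⟩ = (|0⟩ + e^{iφ}|1⟩)/√2` and `H_φ(e^{iφ}|1⟩) = (|0⟩ - e^{iφ}|1⟩)/√2`. -/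
def hadamardMatrix (φ : ℝ) : Matrix (Fin 2) (Fin 2) ℂ :=
  ((1 / Real.sqrt 2 : ℝ) : ℂ) •
    !![1, Complex.exp (-(Complex.I * φ)); Complex.exp (Complex.I * φ), -1]

/-- `¬_φ|0⟩ = e^{iφ}|1⟩` and `¬_φ(e^{iφ}|1⟩) = |0⟩`. -/
def notMatrix (φ : ℝ) : Matrix (Fin 2) (Fin 2) ℂ :=
  !![0, Complex.exp (-(Complex.I * φ)); Complex.exp (Complex.I * φ), 0]

/-- The transformation `H_φ` in the basis `{0,1}¹`. -/
def hadamardGate (φ : ℝ) : Matrix (Qubits 1) (Qubits 1) ℂ :=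
  Matrix.of fun v w => hadamardMatrix φ (v 0) (w 0)

/-- The transformation `c-NOT_φ` in the basis `{0,1}²`:
`|0⟩|ψ⟩ ↦ |0⟩|ψ⟩` and `|1⟩|ψ⟩ ↦ |1⟩(¬_φ|ψ⟩)`. -/
def cNotGate (φ : ℝ) : Matrix (Qubits 2) (Qubits 2) ℂ :=
  Matrix.of fun v w =>
    if v 0 = w 0 then
      (if w 0 = 0 then (1 : Matrix (Fin 2) (Fin 2) ℂ) else notMatrix φ) (v 1) (w 1)
    else 0

/-- The family of the pairs of unitary superoperators induced by `(H_φ, c-NOT_φ)`,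
for `φ ∈ [0, 2π)`. -/
def hadamardCNotFamily : Set GatePair :=
  (fun φ : ℝ => (conjSuper (hadamardGate φ), conjSuper (cNotGate φ))) '' Set.Ico 0 (2 * Real.pi)

/-- The constant term `1/2`. -/
def half : Set.Icc (0 : ℝ) 1 := ⟨1 / 2, by norm_num⟩

open GateVar GateTerm in
/-- The system of twelve experimental equations, each written as
number of qubits, outcome, word, initial state, constant term. -/
def hadamardCNotEquations : Set ExpEquation :=
  { ⟨1, ![0], [(var F, 1)], ![0], half⟩,
    ⟨1, ![0], [(var F, 2)], ![0], 1⟩,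
    ⟨1, ![0], [(var F, 2)], ![1], 0⟩,
    ⟨2, ![0, 0], [(var G, 1)], ![0, 0], 1⟩,
    ⟨2, ![0, 1], [(var G, 1)], ![0, 1], 1⟩,
    ⟨2, ![1, 1], [(var G, 1)], ![1, 0], 1⟩,
    ⟨2, ![1, 0], [(var G, 1)], ![1, 1], 1⟩,
    ⟨2, ![0, 0], [(idTensor 1 F, 1), (var G, 1), (idTensor 1 F, 1)], ![0, 0], 1⟩,
    ⟨2, ![1, 0], [(idTensor 1 F, 1), (var G, 1), (idTensor 1 F, 1)], ![1, 0], 1⟩,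
    ⟨2, ![0, 0], [(tensorId F 1, 1), (var G, 2), (tensorId F 1, 1)], ![0, 0], 1⟩,
    ⟨2, ![0, 1], [(tensorId F 1, 1), (var G, 2), (tensorId F 1, 1)], ![0, 1], 1⟩,
    ⟨2, ![0, 0], [(tensor F F, 1), (var G, 1), (tensor F F, 1)], ![0, 0], 1⟩ }

end QSelfTest

end

/-!
The Choi matrix of a CPSO is positive semidefinite, so its `2 × 2` minors bound every entry of
`S(|k⟩⟨l|)` by diagonal entries of `S(|k⟩⟨k|)` and `S(|l⟩⟨l|)` (`normSq_apply_single_le`). In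
particular, a CPSO that fixes all basis states `|k⟩⟨k|` multiplies the matrix entries by numbers
`cₖₗ` of the closed unit disc, with `cₖₖ = 1`. If it also returns with certainty a single pure state
all of whose amplitudes are nonzero, then all `cₖₗ` are `1`, and it is the identity
(`eq_one_of_fixes`). Both gates are identified by composing the unknown CPSO with the inverse of the
expected gate and applying this rigidity statement.

For `F`, the equations make `F(F(|0⟩⟨0|))` and `F(F(|1⟩⟨1|))` equal to `|0⟩⟨0|` and `|1⟩⟨1|`. The
minors of the Choi matrix then force `F(|0⟩⟨0|)` to be pure (`normSq_offDiag`); as it has diagonal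
`(1/2, 1/2)`, it is the state `H_φ|0⟩` for some `φ`. The CPSO `F ∘ H_φ` fixes `|0⟩⟨0|`. It sends
`H_φ(F(|1⟩⟨1|))` to `|1⟩⟨1|`, and since the probability of the outcome `1` after `F ∘ H_φ` depends
only on the entry at `(1, 1)`, this state is `|1⟩⟨1|`. So `F ∘ H_φ` fixes both basis states, and
also `H_φ|0⟩`, whence it is the identity and `F = H_φ` (`eq_hadamard`).

For `G`, the CPSO `c-NOT_φ ∘ G` fixes the four basis states. The vector `H_φ|0⟩ ⊗ H_φ|0⟩` is fixed
by `c-NOT_φ`, and the last equation says that `G` returns it with certainty, so `c-NOT_φ ∘ G` is the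
identity (`eq_cNot`).
-/

open scoped ComplexOrder

namespace QSelfTest
open Matrix Kronecker

section Superoperators

variable {ι κ : Type*} [Fintype ι] [Fintype κ]

/-! ### Density matrices -/

lemma normSq_le_of_posSemidef {α : Type*} {A : Matrix α α ℂ} (hA : A.PosSemidef) (i j : α) :
    Complex.normSq (A i j) ≤ (A i i).re * (A j j).re := by
  have h := (hA.submatrix ![i, j]).det_nonneg
  have hi := hA.isHermitian.apply i j
  have h1 := (Complex.nonneg_iff.1 (hA.diag_nonneg (i := i))).2
  have h2 := (Complex.nonneg_iff.1 (hA.diag_nonneg (i := j))).2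
  rw [Matrix.det_fin_two] at h
  have h3 := (Complex.nonneg_iff.1 h).1
  simp [← hi, ← h1, ← h2] at h3
  rw [← hi, Complex.normSq_apply]
  simp
  linarith

lemma IsDensity.re_nonneg {ρ : Matrix ι ι ℂ} (hρ : IsDensity ρ) (i : ι) : 0 ≤ (ρ i i).re :=
  (Complex.nonneg_iff.1 (hρ.1.diag_nonneg (i := i))).1

lemma IsDensity.im_eq_zero {ρ : Matrix ι ι ℂ} (hρ : IsDensity ρ) (i : ι) : (ρ i i).im = 0 :=
  (Complex.nonneg_iff.1 (hρ.1.diag_nonneg (i := i))).2.symm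

lemma IsDensity.sum_re {ρ : Matrix ι ι ℂ} (hρ : IsDensity ρ) : ∑ i, (ρ i i).re = 1 := by
  simpa [Matrix.trace] using congrArg Complex.re hρ.2

lemma IsDensity.re_le_one {ρ : Matrix ι ι ℂ} (hρ : IsDensity ρ) (i : ι) : (ρ i i).re ≤ 1 :=
  hρ.sum_re ▸ Finset.single_le_sum (f := fun i => (ρ i i).re) (fun i _ => hρ.re_nonneg i)
    (Finset.mem_univ i)

/-! ### Superoperators of the form `ρ ↦ A ρ A†` -/

@[simp] lemma conjSuper_apply (A ρ : Matrix ι ι ℂ) : conjSuper A ρ = A * ρ * Aᴴ := rfl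

lemma conjSuper_mul (A B : Matrix ι ι ℂ) : conjSuper (A * B) = conjSuper A * conjSuper B := by
  ext1 ρ
  simp [Module.End.mul_apply, Matrix.mul_assoc]

variable [DecidableEq ι] [DecidableEq κ]

@[simp] lemma conjSuper_one : conjSuper (1 : Matrix ι ι ℂ) = 1 := by
  ext1 ρ
  simp

lemma isPSO_conjSuper {A : Matrix ι ι ℂ} (hA : Aᴴ * A = 1) : IsPSO (conjSuper A) := by
  intro ρ hρ
  refine ⟨hρ.1.mul_mul_conjTranspose_same A, ?_⟩
  rw [conjSuper_apply, Matrix.trace_mul_comm, ← Matrix.mul_assoc, hA, Matrix.one_mul, hρ.2]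

lemma superop_ext {S T : Superop ι}
    (h : ∀ i j, S (Matrix.single i j 1) = T (Matrix.single i j 1)) : S = T :=
  Matrix.ext_linearMap ℂ fun i j => LinearMap.ext_ring (h i j)

lemma apply_eq_sum (S : Superop ι) (ρ : Matrix ι ι ℂ) (a b : ι) :
    S ρ a b = ∑ k, ∑ l, ρ k l * S (Matrix.single k l 1) a b := by
  conv_lhs => rw [Matrix.matrix_eq_sum_single ρ]
  have : ∀ k l, S (Matrix.single k l (ρ k l)) = ρ k l • S (Matrix.single k l 1) := by
    intro k l
    rw [← map_smul, Matrix.smul_single, smul_eq_mul, mul_one]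
  simp only [map_sum, this, Matrix.sum_apply, Matrix.smul_apply, smul_eq_mul]

@[simp] lemma superTensor_kronecker (S : Superop ι) (T : Superop κ) (A : Matrix ι ι ℂ)
    (B : Matrix κ κ ℂ) : superTensor S T (A ⊗ₖ B) = S A ⊗ₖ T B := by
  simp [superTensor, LinearEquiv.conj_apply]

lemma superTensor_mul_one (S T : Superop ι) :
    superTensor (S * T) (1 : Superop κ) = superTensor S 1 * superTensor T 1 := by
  simp only [superTensor]
  rw [← (LinearEquiv.conj (kroneckerLinearEquiv ι ι κ κ ℂ)).symm.injective.eq_iff]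
  rw [LinearEquiv.symm_apply_apply, ← mul_one (1 : Superop κ), TensorProduct.map_mul, mul_one,
    Module.End.mul_eq_comp, Module.End.mul_eq_comp, ← LinearEquiv.conj_comp,
    LinearEquiv.symm_apply_apply]

lemma superTensor_conjSuper (A : Matrix ι ι ℂ) (B : Matrix κ κ ℂ) :
    superTensor (conjSuper A) (conjSuper B) = conjSuper (A ⊗ₖ B) := by
  refine superop_ext fun p q => ?_
  have h : (Matrix.single p q (1 : ℂ)) =
      Matrix.single p.1 q.1 1 ⊗ₖ Matrix.single p.2 q.2 1 := by
    simp [Matrix.single_kronecker_single]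
  rw [h, superTensor_kronecker, conjSuper_apply, conjSuper_apply, conjSuper_apply,
    Matrix.conjTranspose_kronecker, Matrix.mul_kronecker_mul, Matrix.mul_kronecker_mul]

lemma isCPSO_conjSuper {A : Matrix ι ι ℂ} (hA : Aᴴ * A = 1) : IsCPSO (conjSuper A) := by
  refine ⟨isPSO_conjSuper hA, fun M _ => ?_⟩
  rw [← conjSuper_one, superTensor_conjSuper]
  apply isPSO_conjSuper
  rw [Matrix.conjTranspose_kronecker, ← Matrix.mul_kronecker_mul, hA]
  simp

lemma IsCPSO.mul {S T : Superop ι} (hS : IsCPSO S) (hT : IsCPSO T) : IsCPSO (S * T) := by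
  refine ⟨fun ρ hρ => hS.1 _ (hT.1 _ hρ), fun M hM => ?_⟩
  rw [superTensor_mul_one]
  exact fun ρ hρ => hS.2 M hM _ (hT.2 M hM _ hρ)

lemma isDensity_single (i : ι) : IsDensity (Matrix.single i i (1 : ℂ)) := by
  refine ⟨?_, by simp⟩
  have h : (Matrix.single i i (1 : ℂ)) = vecMulVec (Pi.single i 1) (star (Pi.single i 1)) := by
    ext a b
    simp [vecMulVec_apply, Matrix.single_apply, Pi.single_apply]
    grind
  rw [h]
  exact posSemidef_vecMulVec_self_star _

/-- A measurement outcome that is certain determines the state. -/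
lemma IsDensity.eq_single {ρ : Matrix ι ι ℂ} (hρ : IsDensity ρ) {i : ι} (h : (ρ i i).re = 1) :
    ρ = Matrix.single i i 1 := by
  have h0 : ∀ j, j ≠ i → (ρ j j).re = 0 := by
    intro j hj
    have hs := hρ.sum_re
    rw [← Finset.add_sum_erase _ _ (Finset.mem_univ i), h, add_eq_left,
      Finset.sum_eq_zero_iff_of_nonneg fun k _ => hρ.re_nonneg k] at hs
    exact hs j (by simp [hj])
  have hz : ∀ a b, (a ≠ i ∨ b ≠ i) → ρ a b = 0 := by
    intro a b hab
    have hn := normSq_le_of_posSemidef hρ.1 a b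
    rw [← Complex.normSq_eq_zero]
    refine le_antisymm ?_ (Complex.normSq_nonneg _)
    rcases hab with ha | hb
    · simpa [h0 a ha] using hn
    · simpa [h0 b hb] using hn
  ext a b
  by_cases hab : a = i ∧ b = i
  · obtain ⟨rfl, rfl⟩ := hab
    simpa using Complex.ext h (hρ.im_eq_zero _)
  · rw [hz a b (by tauto), Matrix.single_apply_of_ne _ _ _ _ _ (by tauto)]

/-! ### The Choi matrix -/

/-- The Choi matrix of a superoperator `S`, with entry `S(|k⟩⟨l|)ₐᵦ` at `((a, k), (b, l))`. -/
def choi (S : Superop ι) : Matrix (ι × ι) (ι × ι) ℂ :=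
  Matrix.of fun p q => S (Matrix.single p.2 q.2 1) p.1 q.1

/-- The Choi matrix is a positive multiple of the image of a maximally entangled state under
`S ⊗ I`. -/
lemma posSemidef_choi {S : Superop ι} (hS : IsCPSO S) : (choi S).PosSemidef := by
  rcases isEmpty_or_nonempty ι with hι | hι
  · rw [Subsingleton.elim (choi S) 0]
    exact .zero
  set M := Fintype.card ι
  have hM : 0 < M := Fintype.card_pos
  let e : ι ≃ Fin M := Fintype.equivFin ι
  let u : ι × Fin M → ℂ := fun p => if e p.1 = p.2 then 1 else 0
  have hsum : vecMulVec u (star u) =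
      ∑ k, ∑ l, Matrix.single k l (1 : ℂ) ⊗ₖ Matrix.single (e k) (e l) (1 : ℂ) := by
    ext ⟨a, x⟩ ⟨b, y⟩
    simp only [Matrix.sum_apply, Matrix.kroneckerMap_apply, vecMulVec_apply, u, Pi.star_apply,
      Matrix.single_apply]
    rw [Finset.sum_eq_single a, Finset.sum_eq_single b] <;> simp +contextual [← ite_and, and_comm]
  have hD : IsDensity ((M : ℂ)⁻¹ • vecMulVec u (star u)) := by
    refine ⟨(posSemidef_vecMulVec_self_star u).smul (by positivity), ?_⟩
    have : (M : ℂ) ≠ 0 := by exact_mod_cast hM.ne'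
    have htr : (vecMulVec u (star u)).trace = M := by
      simp [Matrix.trace, vecMulVec_apply, u, Fintype.sum_prod_type, M]
    rw [Matrix.trace_smul, htr, smul_eq_mul, inv_mul_cancel₀ this]
  have hpos := (hS.2 M hM _ hD).1
  have hC : choi S = (M : ℂ) • ((superTensor S 1 ((M : ℂ)⁻¹ • vecMulVec u (star u))).submatrix
      (fun p => (p.1, e p.2)) (fun p => (p.1, e p.2))) := by
    have : (M : ℂ) ≠ 0 := by exact_mod_cast hM.ne'
    ext ⟨a, k⟩ ⟨b, l⟩
    rw [map_smul, Matrix.smul_apply, Matrix.submatrix_apply, Matrix.smul_apply,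
      smul_smul, mul_inv_cancel₀ this, one_smul, hsum]
    simp only [map_sum, superTensor_kronecker, Matrix.sum_apply, Matrix.kroneckerMap_apply,
      Module.End.one_apply, Matrix.single_apply, EmbeddingLike.apply_eq_iff_eq]
    rw [Finset.sum_eq_single k, Finset.sum_eq_single l] <;> simp +contextual [choi]
  rw [hC]
  exact (hpos.submatrix _).smul (by positivity)

/-- The nonnegativity of the `2 × 2` minors of the Choi matrix. The gates are identified from this
and from the preservation of density matrices alone. -/
lemma normSq_apply_single_le {S : Superop ι} (hS : IsCPSO S) (k l a b : ι) :
    Complex.normSq (S (Matrix.single k l 1) a b) ≤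
      (S (Matrix.single k k 1) a a).re * (S (Matrix.single l l 1) b b).re :=
  normSq_le_of_posSemidef (posSemidef_choi hS) (a, k) (b, l)

lemma apply_single_eq_zero {S : Superop ι} (hS : IsCPSO S) {k l a b : ι}
    (h : S (Matrix.single k k 1) a a = 0 ∨ S (Matrix.single l l 1) b b = 0) :
    S (Matrix.single k l 1) a b = 0 := by
  have hn := normSq_apply_single_le hS k l a b
  rw [← Complex.normSq_eq_zero]
  refine le_antisymm ?_ (Complex.normSq_nonneg _)
  rcases h with h | h <;> simpa [h] using hn

/-! ### CPSOs that fix the basis states -/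

/-- A CPSO that fixes all basis states multiplies every matrix entrywise by a fixed matrix. -/
lemma apply_single_of_fixes {S : Superop ι} (hS : IsCPSO S)
    (h : ∀ k, S (Matrix.single k k 1) = Matrix.single k k 1) (k l : ι) :
    S (Matrix.single k l 1) = S (Matrix.single k l 1) k l • Matrix.single k l 1 := by
  ext a b
  by_cases hab : k = a ∧ l = b
  · obtain ⟨rfl, rfl⟩ := hab
    simp
  · rw [Matrix.smul_apply, Matrix.single_apply_of_ne _ _ _ _ _ hab, smul_zero]
    apply apply_single_eq_zero hS
    rw [h, h]
    by_cases hk : k = a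
    · exact .inr (Matrix.single_apply_of_ne _ _ _ _ _ (by tauto))
    · exact .inl (Matrix.single_apply_of_ne _ _ _ _ _ (by tauto))

lemma apply_of_fixes {S : Superop ι} (hS : IsCPSO S)
    (h : ∀ k, S (Matrix.single k k 1) = Matrix.single k k 1) (ρ : Matrix ι ι ℂ) (a b : ι) :
    S ρ a b = S (Matrix.single a b 1) a b * ρ a b := by
  rw [apply_eq_sum, Finset.sum_eq_single a, Finset.sum_eq_single b, mul_comm]
  · intro l _ hl
    rw [apply_single_of_fixes hS h, Matrix.smul_apply,
      Matrix.single_apply_of_ne _ _ _ _ _ (by tauto), smul_zero, mul_zero]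
  · simp
  · intro k _ hk
    refine Finset.sum_eq_zero fun l _ => ?_
    rw [apply_single_of_fixes hS h, Matrix.smul_apply,
      Matrix.single_apply_of_ne _ _ _ _ _ (by tauto), smul_zero, mul_zero]
  · simp

lemma normSq_multiplier_le_one {S : Superop ι} (hS : IsCPSO S)
    (h : ∀ k, S (Matrix.single k k 1) = Matrix.single k k 1) (k l : ι) :
    Complex.normSq (S (Matrix.single k l 1) k l) ≤ 1 := by
  simpa [h] using normSq_apply_single_le hS k l k l

/-- Rigidity: a CPSO that fixes all basis states and returns with certainty a pure state `ψ` all of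
whose amplitudes are nonzero is the identity. The return probability is an average, with positive
weights, of the real parts of the multipliers, which lie in the closed unit disc. -/
lemma eq_one_of_fixes {S : Superop ι} (hS : IsCPSO S)
    (h : ∀ k, S (Matrix.single k k 1) = Matrix.single k k 1) {ψ : ι → ℂ} (hψ : ∀ i, ψ i ≠ 0)
    (hnorm : ∑ i, Complex.normSq (ψ i) = 1)
    (hfid : ∑ i, ∑ j, star (ψ i) * S (vecMulVec ψ (star ψ)) i j * ψ j = 1) : S = 1 := by
  set c : ι → ι → ℂ := fun i j => S (Matrix.single i j 1) i j with hc
  have hle : ∀ i j, (c i j).re ≤ 1 := fun i j => by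
    have h1 := normSq_multiplier_le_one hS h i j
    rw [Complex.normSq_apply] at h1
    nlinarith [mul_self_nonneg (c i j).im, mul_self_nonneg ((c i j).re - 1)]
  have hterm : ∀ i j, (star (ψ i) * S (vecMulVec ψ (star ψ)) i j * ψ j).re =
      Complex.normSq (ψ i) * Complex.normSq (ψ j) * (c i j).re := by
    intro i j
    have : star (ψ i) * S (vecMulVec ψ (star ψ)) i j * ψ j =
        ((Complex.normSq (ψ i) * Complex.normSq (ψ j) : ℝ) : ℂ) * c i j := by
      rw [apply_of_fixes hS h, vecMulVec_apply, Complex.ofReal_mul, ← Complex.mul_conj,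
        ← Complex.mul_conj]
      simp only [Pi.star_apply, Complex.star_def, hc]
      ring
    rw [this, Complex.re_ofReal_mul]
  have hre : ∑ p : ι × ι, Complex.normSq (ψ p.1) * Complex.normSq (ψ p.2) * (c p.1 p.2).re =
      ∑ p : ι × ι, Complex.normSq (ψ p.1) * Complex.normSq (ψ p.2) := by
    have h1 := congrArg Complex.re hfid
    simp only [Complex.re_sum, hterm, Complex.one_re] at h1
    rw [Fintype.sum_prod_type, Fintype.sum_prod_type, h1]
    simp only [← Finset.mul_sum, hnorm, mul_one]
  have hpos : ∀ i, 0 < Complex.normSq (ψ i) := fun i => Complex.normSq_pos.2 (hψ i)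
  rw [Finset.sum_eq_sum_iff_of_le fun p _ => mul_le_of_le_one_right
    (mul_pos (hpos _) (hpos _)).le (hle _ _)] at hre
  refine superop_ext fun i j => ?_
  have h1 : (c i j).re = 1 := by
    have := hre (i, j) (Finset.mem_univ _)
    rwa [mul_eq_left₀ (mul_pos (hpos _) (hpos _)).ne'] at this
  have h2 := normSq_multiplier_le_one hS h i j
  have h3 : c i j = 1 := by
    change Complex.normSq (c i j) ≤ 1 at h2
    rw [Complex.normSq_apply, h1] at h2
    exact Complex.ext h1 (by rw [Complex.one_im]; nlinarith)
  rw [apply_single_of_fixes hS h]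
  change c i j • _ = _
  rw [h3, one_smul, Module.End.one_apply]

end Superoperators

/-! ### Qubit registers -/

lemma forall_qubits_one {P : Qubits 1 → Prop} : (∀ v, P v) ↔ P ![0] ∧ P ![1] := by
  refine ⟨fun h => ⟨h _, h _⟩, fun h v => ?_⟩
  have : v = ![0] ∨ v = ![1] := by revert v; decide
  rcases this with rfl | rfl <;> tauto

lemma forall_qubits_two {P : Qubits 2 → Prop} :
    (∀ v, P v) ↔ P ![0, 0] ∧ P ![0, 1] ∧ P ![1, 0] ∧ P ![1, 1] := by
  refine ⟨fun h => ⟨h _, h _, h _, h _⟩, fun h v => ?_⟩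
  have : v = ![0, 0] ∨ v = ![0, 1] ∨ v = ![1, 0] ∨ v = ![1, 1] := by revert v; decide
  rcases this with rfl | rfl | rfl | rfl <;> tauto

lemma sum_qubits_one {M : Type*} [AddCommMonoid M] (f : Qubits 1 → M) :
    ∑ v, f v = f ![0] + f ![1] := by
  have : (Finset.univ : Finset (Qubits 1)) = {![0], ![1]} := by decide
  rw [this, Finset.sum_pair (by decide)]

lemma sum_qubits_two {M : Type*} [AddCommMonoid M] (f : Qubits 2 → M) :
    ∑ v, f v = f ![0, 0] + f ![0, 1] + f ![1, 0] + f ![1, 1] := by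
  have : (Finset.univ : Finset (Qubits 2)) = {![0, 0], ![0, 1], ![1, 0], ![1, 1]} := by decide
  rw [this, Finset.sum_insert (by decide), Finset.sum_insert (by decide),
    Finset.sum_pair (by decide)]
  simp only [add_assoc]

/-- The tensor product of two matrices, in the basis of concatenated bit strings. -/
def qubitKronecker {m n : ℕ} (A : Matrix (Qubits m) (Qubits m) ℂ)
    (B : Matrix (Qubits n) (Qubits n) ℂ) : Matrix (Qubits (m + n)) (Qubits (m + n)) ℂ :=
  (A ⊗ₖ B).reindex (Fin.appendEquiv m n) (Fin.appendEquiv m n)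

lemma qubitKronecker_apply (A B : Matrix (Qubits 1) (Qubits 1) ℂ) (v w : Qubits 2) :
    qubitKronecker A B v w = A ![v 0] ![w 0] * B ![v 1] ![w 1] := by
  have h0 : ∀ v : Qubits 2, ((Fin.appendEquiv 1 1).symm v) = (![v 0], ![v 1]) := by decide
  simp [qubitKronecker, h0]

lemma qubitKronecker_mul {m n : ℕ} (A A' : Matrix (Qubits m) (Qubits m) ℂ)
    (B B' : Matrix (Qubits n) (Qubits n) ℂ) :
    qubitKronecker A B * qubitKronecker A' B' = qubitKronecker (A * A') (B * B') := by
  simp only [qubitKronecker, Matrix.reindex_apply, Matrix.mul_kronecker_mul]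
  exact Matrix.submatrix_mul_equiv _ _ _ _ _

lemma qubitKronecker_one {m n : ℕ} : qubitKronecker (1 : Matrix (Qubits m) (Qubits m) ℂ)
    (1 : Matrix (Qubits n) (Qubits n) ℂ) = 1 := by
  simp [qubitKronecker]

lemma qubitTensor_conjSuper {m n : ℕ} (A : Matrix (Qubits m) (Qubits m) ℂ)
    (B : Matrix (Qubits n) (Qubits n) ℂ) :
    qubitTensor (conjSuper A) (conjSuper B) = conjSuper (qubitKronecker A B) := by
  ext1 ρ
  rw [qubitTensor, superTensor_conjSuper]
  ext a b
  simp only [LinearEquiv.conj_apply, LinearMap.comp_apply, LinearEquiv.coe_coe, conjSuper_apply,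
    qubitKronecker, Matrix.coe_reindexLinearEquiv, Matrix.symm_reindexLinearEquiv,
    Matrix.conjTranspose_reindex]
  simp only [Matrix.reindex_apply]
  rw [← Matrix.submatrix_mul_equiv (e₂ := (Fin.appendEquiv m n).symm),
    ← Matrix.submatrix_mul_equiv (e₂ := (Fin.appendEquiv m n).symm)]
  simp

lemma conjSuper_basisState_apply {n : ℕ} (A : Matrix (Qubits n) (Qubits n) ℂ)
    (a b w : Qubits n) : conjSuper A (basisState w) a b = A a w * star (A b w) := by
  rw [conjSuper_apply, basisState, Matrix.mul_apply, Finset.sum_eq_single w]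
  · simp
  · intro b _ hb
    simp [Matrix.mul_single_apply_of_ne _ _ _ _ _ hb]
  · simp

lemma prob_conjSuper_basisState {n : ℕ} (A : Matrix (Qubits n) (Qubits n) ℂ) (v w : Qubits n) :
    prob v (conjSuper A (basisState w)) = Complex.normSq (A v w) := by
  rw [prob, conjSuper_basisState_apply, Complex.star_def, Complex.mul_conj, Complex.ofReal_re]

/-! ### The gates -/

section Gates
variable (φ : ℝ)

lemma hadamardGate_conjTranspose : (hadamardGate φ)ᴴ = hadamardGate φ := by
  ext v w
  revert v w
  simp only [forall_qubits_one]
  simp [hadamardGate, hadamardMatrix, ← Complex.exp_conj]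

lemma inv_sqrt_two_sq : ((Real.sqrt 2 : ℝ) : ℂ)⁻¹ * ((Real.sqrt 2 : ℝ) : ℂ)⁻¹ = 1 / 2 := by
  rw [← mul_inv, ← Complex.ofReal_mul, Real.mul_self_sqrt (by norm_num)]
  norm_num

lemma exp_mul_exp_neg : Complex.exp (Complex.I * φ) * Complex.exp (-(Complex.I * φ)) = 1 := by
  rw [← Complex.exp_add]; simp

lemma hadamardGate_mul_self : hadamardGate φ * hadamardGate φ = 1 := by
  have h1 := inv_sqrt_two_sq
  have h2 := exp_mul_exp_neg φ
  ext v w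
  revert v w
  simp only [forall_qubits_one, Matrix.mul_apply, sum_qubits_one]
  simp [hadamardGate, hadamardMatrix]
  grind

lemma cNotGate_conjTranspose : (cNotGate φ)ᴴ = cNotGate φ := by
  ext v w
  revert v w
  simp only [forall_qubits_two]
  simp [cNotGate, notMatrix, ← Complex.exp_conj]

lemma cNotGate_mul_self : cNotGate φ * cNotGate φ = 1 := by
  have h2 := exp_mul_exp_neg φ
  ext v w
  revert v w
  simp only [forall_qubits_two, Matrix.mul_apply, sum_qubits_two]
  simp [cNotGate, notMatrix, h2, mul_comm]

/-- `c-NOT_φ` fixes `|x⟩ ⊗ H_φ|0⟩` for every `|x⟩`, since `H_φ|0⟩` is fixed by `¬_φ`. -/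
lemma cNotGate_mul_qubitKronecker (A : Matrix (Qubits 1) (Qubits 1) ℂ) (a : Fin 2)
    (v : Qubits 2) :
    (cNotGate φ * qubitKronecker A (hadamardGate φ) : Matrix (Qubits 2) (Qubits 2) ℂ) v ![a, 0] =
      qubitKronecker A (hadamardGate φ) v ![a, 0] := by
  have h2 := exp_mul_exp_neg φ
  revert v
  simp only [forall_qubits_two, Matrix.mul_apply, sum_qubits_two, qubitKronecker_apply]
  simp [hadamardGate, hadamardMatrix, cNotGate, notMatrix]
  grind

/-- Applying `A ⊗ H_φ`, then `c-NOT_φ`, then `A ⊗ H_φ` again returns `|a⟩|0⟩` to itself, if `A` is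
an involution. -/
lemma qubitKronecker_mul_cNotGate_mul {A : Matrix (Qubits 1) (Qubits 1) ℂ} (hA : A * A = 1)
    (a : Fin 2) :
    (qubitKronecker A (hadamardGate φ) * (cNotGate φ * qubitKronecker A (hadamardGate φ)) :
      Matrix (Qubits 2) (Qubits 2) ℂ) ![a, 0] ![a, 0] = 1 := by
  have h := qubitKronecker_mul A A (hadamardGate φ) (hadamardGate φ)
  rw [hA, hadamardGate_mul_self, qubitKronecker_one] at h
  refine Eq.trans ?_ ((congrFun (congrFun h ![a, 0]) ![a, 0]).trans (Matrix.one_apply_eq _))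
  -- A term is used instead of `rw` because the registers `Qubits (1 + 1)` and `Qubits 2` agree only
  -- by definitional unfolding.
  refine Matrix.mul_apply.trans (Eq.trans ?_ Matrix.mul_apply.symm)
  exact Finset.sum_congr rfl fun v _ =>
    congrArg (qubitKronecker A (hadamardGate φ) ![a, 0] v * ·)
      (cNotGate_mul_qubitKronecker φ A a v)

end Gates

/-! ### The equations -/

lemma mem_solutions_iff (p : GatePair) : p ∈ solutions hadamardCNotEquations ↔
    IsCPSO p.1 ∧ IsCPSO p.2 ∧
    prob ![0] (p.1 (basisState ![0])) = 1 / 2 ∧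
    prob ![0] ((p.1 * p.1) (basisState ![0])) = 1 ∧
    prob ![0] ((p.1 * p.1) (basisState ![1])) = 0 ∧
    prob ![0, 0] (p.2 (basisState ![0, 0])) = 1 ∧
    prob ![0, 1] (p.2 (basisState ![0, 1])) = 1 ∧
    prob ![1, 1] (p.2 (basisState ![1, 0])) = 1 ∧
    prob ![1, 0] (p.2 (basisState ![1, 1])) = 1 ∧
    prob ![0, 0] ((qubitTensor (1 : Superop (Qubits 1)) p.1 *
      (p.2 * qubitTensor (1 : Superop (Qubits 1)) p.1) : Superop (Qubits 2))
      (basisState ![0, 0])) = 1 ∧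
    prob ![1, 0] ((qubitTensor (1 : Superop (Qubits 1)) p.1 *
      (p.2 * qubitTensor (1 : Superop (Qubits 1)) p.1) : Superop (Qubits 2))
      (basisState ![1, 0])) = 1 ∧
    prob ![0, 0] ((qubitTensor p.1 (1 : Superop (Qubits 1)) *
      (p.2 * p.2 * qubitTensor p.1 (1 : Superop (Qubits 1))) : Superop (Qubits 2))
      (basisState ![0, 0])) = 1 ∧
    prob ![0, 1] ((qubitTensor p.1 (1 : Superop (Qubits 1)) *
      (p.2 * p.2 * qubitTensor p.1 (1 : Superop (Qubits 1))) : Superop (Qubits 2))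
      (basisState ![0, 1])) = 1 ∧
    prob ![0, 0] ((qubitTensor p.1 p.1 * (p.2 * qubitTensor p.1 p.1) : Superop (Qubits 2))
      (basisState ![0, 0])) = 1 := by
  simp only [solutions, Set.mem_ofPred_eq, hadamardCNotEquations, Set.mem_insert_iff,
    Set.mem_singleton_iff, forall_eq_or_imp, forall_eq, ExpEquation.Holds, GateTerm.eval,
    GateVar.eval, List.map_cons, List.map_nil, List.prod_cons, List.prod_nil, pow_one, pow_two,
    mul_one, half, Set.Icc.coe_one, Set.Icc.coe_zero]

/-- Every member of the family satisfies the equations. -/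
lemma mem_solutions_of_angle (φ : ℝ) :
    (conjSuper (hadamardGate φ), conjSuper (cNotGate φ)) ∈ solutions hadamardCNotEquations := by
  have h1 := inv_sqrt_two_sq
  have h2 := exp_mul_exp_neg φ
  have hH := hadamardGate_mul_self φ
  have hC := cNotGate_mul_self φ
  rw [mem_solutions_iff]
  refine ⟨isCPSO_conjSuper (by rwa [hadamardGate_conjTranspose]),
    isCPSO_conjSuper (by rwa [cNotGate_conjTranspose]), ?_⟩
  simp only [← conjSuper_one, qubitTensor_conjSuper, ← conjSuper_mul, hH, hC,
    prob_conjSuper_basisState, Matrix.one_mul, qubitKronecker_mul, qubitKronecker_one]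
  refine ⟨?_, ?_, ?_, ?_, ?_, ?_, ?_, ?_, ?_, ?_, ?_, ?_⟩
  · simp [hadamardGate, hadamardMatrix]
  · simp
  · simp
  · simp [cNotGate]
  · simp [cNotGate]
  · simp [cNotGate, notMatrix, Complex.normSq_eq_norm_sq, Complex.norm_exp]
  · simp [cNotGate, notMatrix, Complex.normSq_eq_norm_sq, Complex.norm_exp]
  · rw [qubitKronecker_mul_cNotGate_mul φ (one_mul 1), Complex.normSq_one]
  · rw [qubitKronecker_mul_cNotGate_mul φ (one_mul 1), Complex.normSq_one]
  · simp
  · simp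
  · rw [qubitKronecker_mul_cNotGate_mul φ hH, Complex.normSq_one]

/-! ### Identifying the Hadamard gate -/

lemma exists_angle {z : ℂ} (hz : ‖z‖ = 1) :
    ∃ φ ∈ Set.Ico 0 (2 * Real.pi), z = Complex.exp (Complex.I * φ) := by
  refine ⟨toIcoMod Real.two_pi_pos 0 z.arg, by simpa using toIcoMod_mem_Ico Real.two_pi_pos 0 _, ?_⟩
  conv_lhs => rw [← Complex.norm_mul_exp_arg_mul_I z, hz]
  rw [Complex.ofReal_one, one_mul, Complex.exp_eq_exp_iff_exists_int]
  refine ⟨toIcoDiv Real.two_pi_pos 0 z.arg, ?_⟩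
  rw [toIcoMod, zsmul_eq_mul]
  push_cast
  ring

/-- The image `ρ` of `|0⟩⟨0|` is pure. Otherwise `ρ` would be positive definite, but the positive
functional `τ ↦ ⟨1|F(τ)|1⟩` is nonzero and vanishes at `ρ`. -/
lemma normSq_offDiag {F : Superop (Qubits 1)} (hF : IsCPSO F)
    (h0 : prob ![0] (F (basisState ![0])) = 1 / 2)
    (h00 : F (F (basisState ![0])) = basisState ![0]) :
    Complex.normSq (F (basisState ![0]) ![1] ![0]) = 1 / 4 := by
  set ρ := F (basisState ![0]) with hρ
  have hd : IsDensity ρ := hF.1 _ (isDensity_single _)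
  have hr0 : (ρ ![0] ![0]).re = 1 / 2 := h0
  have hr1 : (ρ ![1] ![1]).re = 1 / 2 := by
    have := hd.sum_re
    rw [sum_qubits_one] at this
    linarith
  set b := (F (basisState ![1]) ![1] ![1]).re with hb
  have hb0 : 0 ≤ b := (hF.1 _ (isDensity_single _)).re_nonneg _
  have hp := normSq_le_of_posSemidef hd.1 ![1] ![0]
  have hq1 := normSq_apply_single_le hF ![0] ![1] ![1] ![1]
  have hq2 := normSq_apply_single_le hF ![1] ![0] ![1] ![1]
  change _ ≤ (ρ ![1] ![1]).re * b at hq1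
  change _ ≤ b * (ρ ![1] ![1]).re at hq2
  have hsum := congrArg Complex.re (apply_eq_sum F ρ ![1] ![1])
  rw [h00, sum_qubits_one, sum_qubits_one, sum_qubits_one] at hsum
  have hherm : ‖ρ ![0] ![1]‖ = ‖ρ ![1] ![0]‖ := by
    rw [← hd.1.isHermitian.apply, norm_star]
  have hx := Complex.abs_re_le_norm (ρ ![0] ![1] * F (Matrix.single ![0] ![1] 1) ![1] ![1])
  have hy := Complex.abs_re_le_norm (ρ ![1] ![0] * F (Matrix.single ![1] ![0] 1) ![1] ![1])
  rw [norm_mul] at hx hy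
  rw [hherm] at hx
  have e0 : (ρ ![0] ![0] * F (Matrix.single ![0] ![0] 1) ![1] ![1]).re = 1 / 4 := by
    change (ρ ![0] ![0] * ρ ![1] ![1]).re = 1 / 4
    rw [Complex.mul_re, hd.im_eq_zero, hr0, hr1]
    norm_num
  have e1 : (ρ ![1] ![1] * F (Matrix.single ![1] ![1] 1) ![1] ![1]).re = b / 2 := by
    rw [Complex.mul_re, hd.im_eq_zero, hr1, hb, basisState]
    ring
  have e2 : (basisState (![0] : Qubits 1) ![1] ![1]).re = 0 := by simp [basisState]
  rw [Complex.add_re, Complex.add_re, Complex.add_re, e0, e1, e2] at hsum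
  simp only [Complex.normSq_eq_norm_sq] at *
  generalize ‖ρ ![1] ![0]‖ = p at *
  generalize ‖F (Matrix.single ![0] ![1] 1) ![1] ![1]‖ = q at *
  generalize ‖F (Matrix.single ![1] ![0] 1) ![1] ![1]‖ = r at *
  -- The vanishing of `⟨1|F(ρ)|1⟩` forces the off-diagonal entries of `ρ` to be large: the bound
  -- `(1/4 + b/2)² ≤ 2 p² b` and `(1/4 + b/2)² ≥ b/2` give `p² ≥ 1/4`.
  have hle : 1 / 4 + b / 2 ≤ p * (q + r) := by
    linarith [neg_le_of_abs_le hx, neg_le_of_abs_le hy]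
  rw [hr1] at hq1 hq2
  rw [hr0, hr1] at hp
  have hqr : (q + r) ^ 2 ≤ 2 * b := by nlinarith [sq_nonneg (q - r)]
  have hsq : (1 / 4 + b / 2) ^ 2 ≤ p ^ 2 * (2 * b) :=
    calc (1 / 4 + b / 2) ^ 2 ≤ (p * (q + r)) ^ 2 := pow_le_pow_left₀ (by positivity) hle 2
      _ = p ^ 2 * (q + r) ^ 2 := by ring
      _ ≤ p ^ 2 * (2 * b) := by gcongr
  have hbpos : 0 < b := by
    rcases hb0.eq_or_lt with hb | hb
    · rw [← hb] at hsq; norm_num at hsq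
    · exact hb
  refine le_antisymm (by linarith) ?_
  nlinarith [sq_nonneg (1 / 4 - b / 2)]

/-- Purity of `F(|0⟩⟨0|)` gives the angle `φ`, and then `F ∘ H_φ` satisfies the hypotheses of
`eq_one_of_fixes`. -/
lemma eq_hadamard {F : Superop (Qubits 1)} (hF : IsCPSO F)
    (h1 : prob ![0] (F (basisState ![0])) = 1 / 2)
    (h2 : prob ![0] ((F * F) (basisState ![0])) = 1)
    (h3 : prob ![0] ((F * F) (basisState ![1])) = 0) :
    ∃ φ ∈ Set.Ico 0 (2 * Real.pi), F = conjSuper (hadamardGate φ) := by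
  have hd0 : IsDensity (F (basisState ![0])) := hF.1 _ (isDensity_single _)
  have hd1 : IsDensity (F (basisState ![1])) := hF.1 _ (isDensity_single _)
  have h00 : F (F (basisState ![0])) = basisState ![0] := (hF.1 _ hd0).eq_single h2
  have h11 : F (F (basisState ![1])) = basisState ![1] := by
    refine (hF.1 _ hd1).eq_single ?_
    have := (hF.1 _ hd1).sum_re
    rw [sum_qubits_one] at this
    change (F (F _) _ _).re = 0 at h3
    linarith
  have hoff := normSq_offDiag hF h1 h00
  obtain ⟨φ, hφ, hz⟩ := exists_angle (z := 2 * F (basisState ![0]) ![1] ![0]) (by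
    rw [Complex.normSq_eq_norm_sq] at hoff
    rw [norm_mul, Complex.norm_ofNat]
    nlinarith [norm_nonneg (F (basisState ![0]) ![1] ![0])])
  refine ⟨φ, hφ, ?_⟩
  have hi := inv_sqrt_two_sq
  have he := exp_mul_exp_neg φ
  set H := conjSuper (hadamardGate φ) with hH
  have hHH : H * H = 1 := by rw [hH, ← conjSuper_mul, hadamardGate_mul_self, conjSuper_one]
  have hHH' : ∀ ρ, H (H ρ) = ρ := fun ρ => LinearMap.congr_fun hHH ρ
  have hHc : IsCPSO H :=
    isCPSO_conjSuper (by rw [hadamardGate_conjTranspose, hadamardGate_mul_self])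
  have hF0 : F (basisState ![0]) = H (basisState ![0]) := by
    have hr0 : (F (basisState ![0]) ![0] ![0]) = 1 / 2 :=
      Complex.ext (by simpa [prob] using h1) (by simpa using hd0.im_eq_zero _)
    have hr1 : (F (basisState ![0]) ![1] ![1]) = 1 / 2 := by
      have := hd0.2
      rw [Matrix.trace, sum_qubits_one, Matrix.diag_apply, Matrix.diag_apply, hr0] at this
      linear_combination this
    have hr10 : F (basisState ![0]) ![1] ![0] = Complex.exp (Complex.I * φ) / 2 := by
      rw [← hz]; ring
    have hr01 : F (basisState ![0]) ![0] ![1] = Complex.exp (-(Complex.I * φ)) / 2 := by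
      rw [← hd0.1.isHermitian.apply, hr10]
      simp [← Complex.exp_conj]
    ext a b
    revert a b
    simp only [forall_qubits_one, hH, conjSuper_basisState_apply, hr0, hr1, hr10, hr01]
    simp [hadamardGate, hadamardMatrix, ← Complex.exp_conj]
    grind
  set K := F * H with hK
  have hKc : IsCPSO K := hF.mul hHc
  have hK0 : K (basisState ![0]) = basisState ![0] := by
    rw [hK, Module.End.mul_apply, ← hF0, h00]
  have hσ : IsDensity (H (F (basisState ![1]))) := hHc.1 _ hd1
  have hKσ : K (H (F (basisState ![1]))) = basisState ![1] := by
    rw [hK, Module.End.mul_apply, hHH', h11]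
  -- The outcome `1` has probability `0` on `K|0⟩⟨0|`, so on `Kρ` it only sees the entry `ρ₁₁`.
  have hσ1 : H (F (basisState ![1])) = basisState ![1] := by
    refine hσ.eq_single ?_
    set σ := H (F (basisState ![1]))
    have hz : K (Matrix.single ![0] ![0] 1) ![1] ![1] = 0 := by
      change K (basisState ![0]) ![1] ![1] = 0
      rw [hK0]; simp [basisState]
    have hs := apply_eq_sum K σ ![1] ![1]
    rw [hKσ, sum_qubits_one, sum_qubits_one, sum_qubits_one, hz,
      apply_single_eq_zero hKc (.inl hz), apply_single_eq_zero hKc (.inr hz)] at hs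
    have hs := congrArg Complex.re hs
    have hd := hKc.1 _ (isDensity_single ![1])
    simp only [mul_zero, zero_add, Complex.mul_re, hd.im_eq_zero, sub_zero] at hs
    simp only [basisState, Matrix.single_apply_same, Complex.one_re] at hs
    nlinarith [hd.re_le_one ![1], hσ.re_le_one ![1], hd.re_nonneg ![1], hσ.re_nonneg ![1]]
  have hK1 : K (basisState ![1]) = basisState ![1] := by rw [← hσ1, hKσ, hσ1]
  have hfix : ∀ k, K (Matrix.single k k 1) = Matrix.single k k 1 :=
    forall_qubits_one.2 ⟨hK0, hK1⟩
  have hKone : K = 1 := by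
    have hKF : K (F (basisState ![0])) = F (basisState ![0]) := by
      rw [hK, Module.End.mul_apply, hF0, hHH', hF0]
    have hvec : F (basisState ![0]) =
        vecMulVec (fun v => hadamardGate φ v ![0]) (star fun v => hadamardGate φ v ![0]) := by
      ext a b
      rw [hF0, conjSuper_basisState_apply]
      rfl
    rw [hvec] at hKF
    refine eq_one_of_fixes hKc hfix (ψ := fun v => hadamardGate φ v ![0]) ?_ ?_ ?_
    · simp [forall_qubits_one, hadamardGate, hadamardMatrix]
    · simp [sum_qubits_one, hadamardGate, hadamardMatrix, Complex.normSq_eq_norm_sq,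
        Complex.norm_exp]
      norm_num
    · simp only [hKF, sum_qubits_one, vecMulVec_apply, Pi.star_apply]
      simp [hadamardGate, hadamardMatrix, ← Complex.exp_conj]
      grind
  calc F = F * (H * H) := by rw [hHH, mul_one]
    _ = H := by rw [← mul_assoc, ← hK, hKone, one_mul]

/-! ### Identifying the controlled NOT gate -/

/-- `c-NOT_φ ∘ G` fixes the basis states, and also returns `H_φ|0⟩ ⊗ H_φ|0⟩`, a state fixed by
`c-NOT_φ` whose amplitudes are all nonzero. -/
lemma eq_cNot {G : Superop (Qubits 2)} (hG : IsCPSO G) (φ : ℝ)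
    (h00 : prob ![0, 0] (G (basisState ![0, 0])) = 1)
    (h01 : prob ![0, 1] (G (basisState ![0, 1])) = 1)
    (h10 : prob ![1, 1] (G (basisState ![1, 0])) = 1)
    (h11 : prob ![1, 0] (G (basisState ![1, 1])) = 1)
    (T : Matrix (Qubits 2) (Qubits 2) ℂ)
    (hT : T = qubitKronecker (hadamardGate φ) (hadamardGate φ))
    (h : prob ![0, 0] ((conjSuper T * (G * conjSuper T)) (basisState ![0, 0])) = 1) :
    G = conjSuper (cNotGate φ) := by
  set C := cNotGate φ with hC
  have hCC : conjSuper C * conjSuper C = 1 := by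
    rw [← conjSuper_mul, cNotGate_mul_self, conjSuper_one]
  have hCc : IsCPSO (conjSuper C) :=
    isCPSO_conjSuper (by rw [cNotGate_conjTranspose, cNotGate_mul_self])
  set K := conjSuper C * G with hK
  have hKc : IsCPSO K := hCc.mul hG
  have hGK : G = conjSuper C * K := by rw [hK, ← mul_assoc, hCC, one_mul]
  have hstep : ∀ v w : Qubits 2, prob w (G (basisState v)) = 1 → Complex.normSq (C v w) = 1 →
      K (basisState v) = basisState v := by
    intro v w hv hn
    have h1 : G (basisState v) = basisState w := (hG.1 _ (isDensity_single v)).eq_single hv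
    rw [hK, Module.End.mul_apply, h1]
    refine (hCc.1 _ (isDensity_single w)).eq_single ?_
    exact (prob_conjSuper_basisState C v w).trans hn
  have hfix : ∀ k, K (Matrix.single k k 1) = Matrix.single k k 1 := by
    refine forall_qubits_two.2 ⟨hstep _ _ h00 ?_, hstep _ _ h01 ?_, hstep _ _ h10 ?_,
      hstep _ _ h11 ?_⟩ <;>
    simp [hC, cNotGate, notMatrix, Complex.normSq_eq_norm_sq, Complex.norm_exp]
  have hTH : Tᴴ = T := by
    ext v w
    rw [Matrix.conjTranspose_apply, hT, qubitKronecker_apply, qubitKronecker_apply, star_mul',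
      ← Matrix.conjTranspose_apply, ← Matrix.conjTranspose_apply, hadamardGate_conjTranspose]
  have hCT : ∀ v, (C * T) v ![0, 0] = T v ![0, 0] := fun v => by
    rw [hT]
    exact cNotGate_mul_qubitKronecker φ (hadamardGate φ) 0 v
  have hTC : ∀ v, (T * C) ![0, 0] v = star (T v ![0, 0]) := fun v => by
    rw [← hCT, ← Matrix.conjTranspose_apply, Matrix.conjTranspose_mul, hTH,
      cNotGate_conjTranspose]
  have hKone : K = 1 := by
    refine eq_one_of_fixes hKc hfix (ψ := fun v => T v ![0, 0]) ?_ ?_ ?_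
    · simp [forall_qubits_two, hT, qubitKronecker_apply, hadamardGate, hadamardMatrix]
    · simp [sum_qubits_two, hT, qubitKronecker_apply, hadamardGate, hadamardMatrix,
        Complex.normSq_eq_norm_sq, Complex.norm_exp, mul_pow]
      norm_num
    · set ψ : Qubits 2 → ℂ := fun v => T v ![0, 0]
      have hvec : conjSuper T (basisState ![0, 0]) = vecMulVec ψ (star ψ) := by
        ext a b
        rw [conjSuper_basisState_apply]
        rfl
      have hTT : T * T = 1 := by
        have := qubitKronecker_mul (hadamardGate φ) (hadamardGate φ) (hadamardGate φ)
          (hadamardGate φ)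
        rwa [hadamardGate_mul_self, qubitKronecker_one, ← hT] at this
      have hTc : IsCPSO (conjSuper T) := isCPSO_conjSuper (by rw [hTH, hTT])
      have hd := (hTc.mul (hG.mul hTc)).1 _ (isDensity_single ![0, 0])
      have hX : (conjSuper T * (G * conjSuper T)) (basisState ![0, 0]) =
          conjSuper (T * C) (K (vecMulVec ψ (star ψ))) := by
        rw [← hvec, hGK, conjSuper_mul]
        simp only [Module.End.mul_apply]
      have hone := congrFun (congrFun (hX.symm.trans (hd.eq_single h)) ![0, 0]) ![0, 0]
      rw [Matrix.single_apply_same, conjSuper_apply, Matrix.mul_apply] at hone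
      rw [Finset.sum_comm, ← hone]
      refine Finset.sum_congr rfl fun j _ => ?_
      rw [Matrix.mul_apply, Finset.sum_mul, Matrix.conjTranspose_apply, hTC, star_star]
      exact Finset.sum_congr rfl fun i _ => by rw [hTC]
  rw [hGK, hKone, mul_one]

end QSelfTest

theorem theorem4 :
    QSelfTest.Characterizes QSelfTest.hadamardCNotEquations QSelfTest.hadamardCNotFamily := by
  refine ⟨by simp [QSelfTest.hadamardCNotEquations], Set.Subset.antisymm ?_ ?_⟩
  · rintro ⟨F, G⟩ hp
    obtain ⟨hF, hG, h1, h2, h3, h4, h5, h6, h7, -, -, -, -, h12⟩ :=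
      (QSelfTest.mem_solutions_iff _).1 hp
    obtain ⟨φ, hφ, rfl⟩ := QSelfTest.eq_hadamard hF h1 h2 h3
    refine ⟨φ, hφ, ?_⟩
    simp only [QSelfTest.qubitTensor_conjSuper] at h12
    exact Prod.ext rfl (QSelfTest.eq_cNot hG φ h4 h5 h6 h7 _ rfl h12).symm
  · rintro _ ⟨φ, -, rfl⟩
    exact QSelfTest.mem_solutions_of_angle φ
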